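/- Let $q$ be a prime power, $\mathbb{F}_q$ the finite field with $q$ elements, and let $\mathrm{Int}(\mathbb{F}_q[t]) = \{f \in \mathbb{F}_q(t)[X] \mid f(\mathbb{F}_q[t]) \subseteq \mathbb{F}_q[t]\}$ be the ring of integer-valued polynomials on $\mathbb{F}_q[t]$. For $m \ge 0$ put $$\psi_m(X) = \prod_{f \in \mathbb{F}_q[t],\ \deg f < m} (X - f), \qquad F_m = \prod_{j=1}^{m} \bigl(t^{q^j} - t\bigr)^{q^{m-j}},$$ where $\deg 0 = -\infty$, so that $\psi_0 = X$ and $F_0 = 1$. For a non-negative integer $k = \alpha_0 + \alpha_1 q + \dots + \alpha_s q^s$ with base-$q$ digits $\alpha_i \in \{0,\dots,q-1\}$, the $k$-th Carlitz binomial polynomial is $$\beta_k(X) = \frac{\psi_0(X)^{\alpha_0} \cdots \psi_s(X)^{\alpha_s}}{F_0^{\alpha_0} \cdots F_s^{\alpha_s}} \in \mathbb{F}_q(t)[X].$$ Then $\beta_k \in \mathrm{Int}(\mathbb{F}_q[t])$ for all $k \ge 0$, and the following hold. (1) For every positive integer $k$, the polynomial $\beta_k$ is irreducible in $\mathrm{Int}(\mathbb{F}_q[t])$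 if and only if $k = q^s$ for some integer $s \ge 0$. More precisely, writing $k = \alpha_0 + \alpha_1 q + \dots + \alpha_s q^s$ with $s \ge 0$, $\alpha_i \in \{0,\dots,q-1\}$ and $\alpha_s \ne 0$, one has $$\beta_k = \prod_{i=0}^{s} (\beta_{q^i})^{\alpha_i}.$$ (2) For every integer $s \ge 0$, the polynomial $\beta_{q^s}$ is absolutely irreducible in $\mathrm{Int}(\mathbb{F}_q[t])$; that is, it is irreducible and for every integer $m \ge 1$ the power $\beta_{q^s}^m$ factors uniquely as a product of irreducible elements of $\mathrm{Int}(\mathbb{F}_q[t])$, up to the order of the factors and multiplication by units. -/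

import Mathlib

open Polynomial

noncomputable section

/-- The ring `Int(D) = {f ∈ K[X] | f(D) ⊆ D}` of integer-valued polynomials on `D`,
where `K` is an overfield of `D`. -/
def integerValuedPolynomials (D K : Type*) [CommRing D] [Field K] [Algebra D K] :
    Subring K[X] where
  carrier := {f | ∀ a : D, f.eval (algebraMap D K a) ∈ (algebraMap D K).range}
  mul_mem' := fun hf hg a => by
    rw [eval_mul]
    exact Subring.mul_mem _ (hf a) (hg a)
  one_mem' := fun a => by
    rw [eval_one]
    exact Subring.one_mem _
  add_mem' := fun hf hg a => by
    rw [eval_add]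
    exact Subring.add_mem _ (hf a) (hg a)
  zero_mem' := fun a => by
    rw [eval_zero]
    exact Subring.zero_mem _
  neg_mem' := fun hf a => by
    rw [eval_neg]
    exact Subring.neg_mem _ (hf a)

/-- `a` is a product of irreducible elements, in a unique way up to the order of the factors and
associatedness. -/
def FactorsUniquely {R : Type*} [CommMonoid R] (a : R) : Prop :=
  (∃ u : Multiset R, (∀ b ∈ u, Irreducible b) ∧ u.prod = a) ∧
    ∀ u v : Multiset R, (∀ b ∈ u, Irreducible b) → (∀ b ∈ v, Irreducible b) →
      u.prod = a → v.prod = a → Multiset.Rel Associated u v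

/-- `a` is irreducible and all its powers with positive exponent factor uniquely into
irreducible elements. -/
def AbsolutelyIrreducible {R : Type*} [CommMonoid R] (a : R) : Prop :=
  Irreducible a ∧ ∀ m : ℕ, 0 < m → FactorsUniquely (a ^ m)

theorem finite_setOf_degree_lt (F : Type*) [Field F] [Fintype F] (m : ℕ) :
    {f : F[X] | f.degree < m}.Finite := by
  have h : Finite (degreeLT F m) := Finite.of_equiv _ (degreeLTEquiv F m).symm.toEquiv
  have h2 : {f : F[X] | f.degree < m} = (degreeLT F m : Set F[X]) := by
    ext f
    simp [mem_degreeLT]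
  rw [h2]
  exact Set.toFinite _

/-- `ψ_m(X) = ∏ (X - f)`, the product over all `f ∈ 𝔽_q[t]` with `deg f < m`. -/
def carlitzPsi (F : Type*) [Field F] [Fintype F] (m : ℕ) : (RatFunc F)[X] :=
  ∏ f ∈ (finite_setOf_degree_lt F m).toFinset, (X - C (algebraMap F[X] (RatFunc F) f))

/-- `F_m = (t^(q^m) - t) (t^(q^(m-1)) - t)^q ⋯ (t^q - t)^(q^(m-1)) ∈ 𝔽_q[t]`, with `F_0 = 1`.
Here the polynomial variable `X` plays the role of `t`. -/
def carlitzF (F : Type*) [Field F] [Fintype F] (m : ℕ) : F[X] :=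
  ∏ j ∈ Finset.Icc 1 m, (X ^ (Fintype.card F ^ j) - X) ^ (Fintype.card F ^ (m - j))

/-- `G_k = ∏ ψ_i ^ α_i`, where the `α_i` are the base-`q` digits of `k`. -/
def carlitzG (F : Type*) [Field F] [Fintype F] (k : ℕ) : (RatFunc F)[X] :=
  ∏ i ∈ Finset.range (Nat.digits (Fintype.card F) k).length,
    carlitzPsi F i ^ (Nat.digits (Fintype.card F) k).getD i 0

/-- `g_k = ∏ F_i ^ α_i`, where the `α_i` are the base-`q` digits of `k`. -/
def carlitzg (F : Type*) [Field F] [Fintype F] (k : ℕ) : F[X] :=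
  ∏ i ∈ Finset.range (Nat.digits (Fintype.card F) k).length,
    carlitzF F i ^ (Nat.digits (Fintype.card F) k).getD i 0

/-- The `k`-th Carlitz binomial polynomial `β_k = G_k / g_k ∈ 𝔽_q(t)[X]`. -/
def carlitzBinomial (F : Type*) [Field F] [Fintype F] (k : ℕ) : (RatFunc F)[X] :=
  C (algebraMap F[X] (RatFunc F) (carlitzg F k))⁻¹ * carlitzG F k

end

/-! ### Values of `ψ_s` on `F[t]`: linearity, recursion and divisibility by `F_s` -/

section CarlitzMap

variable (F : Type*) [Field F] [Fintype F]

/-! Write `E_s = ψ_s / F_s`, which is `β_(q^s)`. On `F[t]` the map `ψ_s` is `F`-linear, has values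
divisible by `F_s`, and equals `F_s` at every monic `a` of degree `s`. So each `E_s` is
integer-valued with `E_s(a) = 1` at such `a`, and each `β_k` is a product of powers of the `E_i`.

Suppose `g * h = E_s ^ m` with `g`, `h` integer-valued. Then `g(a)` is a unit for each monic `a` of
degree `s`, and `g = c ∏ (X - f) ^ e f` over `deg f < s`. For `s > 0` take `P` monic irreducible of
degree `s`. At `P + f₀` the product has `P`-adic valuation exactly `e f₀`, since `P` divides no
nonzero `f₀ - f`. The values of the product at monic `a` are all associated, so `e` is constant
(`exponent_eq_of_associated`) and `g` is a unit times a power of `E_s`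
(`eq_C_mul_carlitzE_pow_of_mul_eq`).

Thus divisors of powers of `E_s` are powers of `E_s` up to units, which is absolute irreducibility.
If `β_k` is irreducible, splitting off `E_s` for the top digit leaves a unit, and comparing degrees
gives `k = q^s`. -/

theorem carlitzF_zero : carlitzF F 0 = 1 := by
  simp [carlitzF]

theorem carlitzF_succ (s : ℕ) :
    carlitzF F (s + 1) =
      (X ^ Fintype.card F ^ (s + 1) - X) * carlitzF F s ^ Fintype.card F := by
  rw [carlitzF, Finset.prod_Icc_succ_top (by omega), mul_comm, carlitzF, ← Finset.prod_pow]
  congr 1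
  · simp
  · refine Finset.prod_congr rfl fun j hj => ?_
    rw [← pow_mul, ← pow_succ, Nat.succ_sub (Finset.mem_Icc.mp hj).2]

theorem carlitzF_ne_zero (s : ℕ) : carlitzF F s ≠ 0 := by
  refine Finset.prod_ne_zero_iff.mpr fun j hj => pow_ne_zero _ ?_
  exact FiniteField.X_pow_card_pow_sub_X_ne_zero F
    (by have := (Finset.mem_Icc.mp hj).1; omega) Fintype.one_lt_card

/-- The `F`-linear map on `F[t]` given by evaluating the polynomial `ψ_s`, defined through the
recursion `ψ_(s+1) = ψ_s ^ q - F_s ^ (q - 1) ψ_s`. -/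
noncomputable def carlitzMap : ℕ → F[X] →ₗ[F] F[X]
  | 0 => LinearMap.id
  | s + 1 => (FiniteField.frobeniusAlgHom F F[X]).toLinearMap ∘ₗ carlitzMap s -
      LinearMap.mulLeft F (carlitzF F s ^ (Fintype.card F - 1)) ∘ₗ carlitzMap s

theorem carlitzMap_zero (a : F[X]) : carlitzMap F 0 a = a := rfl

theorem carlitzMap_succ (s : ℕ) (a : F[X]) :
    carlitzMap F (s + 1) a = carlitzMap F s a ^ Fintype.card F -
      carlitzF F s ^ (Fintype.card F - 1) * carlitzMap F s a := rfl

theorem add_pow_fintypeCard (a b : F[X]) :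
    (a + b) ^ Fintype.card F = a ^ Fintype.card F + b ^ Fintype.card F :=
  map_add (FiniteField.frobeniusAlgHom F F[X]) a b

theorem sub_pow_fintypeCard (a b : F[X]) :
    (a - b) ^ Fintype.card F = a ^ Fintype.card F - b ^ Fintype.card F :=
  map_sub (FiniteField.frobeniusAlgHom F F[X]) a b

/-- The factor `t^(q^(s+1)) - t` is the one in `F_(s+1) = (t^(q^(s+1)) - t) F_s ^ q`, so this
identity lets both the value at `t^s` and divisibility by `F_s` be proved by induction. -/
theorem carlitzMap_succ_X_mul (s : ℕ) (a : F[X]) :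
    carlitzMap F (s + 1) (X * a) = X * carlitzMap F (s + 1) a +
      (X ^ Fintype.card F ^ (s + 1) - X) * carlitzMap F s a ^ Fintype.card F := by
  induction s with
  | zero => simp [carlitzMap_succ, carlitzMap_zero, carlitzF_zero]; ring
  | succ s ih =>
    have hT : (X ^ Fintype.card F ^ (s + 1 + 1) - X : F[X]) =
        (X ^ Fintype.card F ^ (s + 1) - X) ^ Fintype.card F + X ^ Fintype.card F - X := by
      rw [sub_pow_fintypeCard, ← pow_mul, ← pow_succ]; ring
    have hz := carlitzMap_succ F s a
    have hF := carlitzF_succ F s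
    have hH : carlitzF F (s + 1) ^ (Fintype.card F - 1) * (X ^ Fintype.card F ^ (s + 1) - X) =
        (X ^ Fintype.card F ^ (s + 1) - X) ^ Fintype.card F *
          (carlitzF F s ^ (Fintype.card F - 1)) ^ Fintype.card F := by
      obtain ⟨n, hn⟩ : ∃ n, Fintype.card F = n + 1 :=
        ⟨_, (Nat.succ_pred Fintype.card_ne_zero).symm⟩
      rw [hF, hn, Nat.add_sub_cancel, ← hn]
      generalize (X ^ Fintype.card F ^ (s + 1) - X : F[X]) = T
      rw [hn]
      ring
    rw [carlitzMap_succ F (s + 1), carlitzMap_succ F (s + 1), ih, hT]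
    set z := carlitzMap F (s + 1) a
    set y := carlitzMap F s a
    set T : F[X] := X ^ Fintype.card F ^ (s + 1) - X
    have hzq : z ^ Fintype.card F = (y ^ Fintype.card F) ^ Fintype.card F -
        (carlitzF F s ^ (Fintype.card F - 1)) ^ Fintype.card F * y ^ Fintype.card F := by
      rw [hz, sub_pow_fintypeCard, mul_pow]
    rw [add_pow_fintypeCard, mul_pow, mul_pow]
    linear_combination (-y ^ Fintype.card F) * hH - T ^ Fintype.card F * hzq

theorem carlitzMap_vanish_and_X_pow (s : ℕ) :
    (∀ a : F[X], a.degree < s → carlitzMap F s a = 0) ∧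
      carlitzMap F s (X ^ s) = carlitzF F s := by
  induction s with
  | zero =>
    refine ⟨fun a ha => ?_, by simp [carlitzMap_zero, carlitzF_zero]⟩
    rw [carlitzMap_zero, ← degree_eq_bot]
    simpa using ha
  | succ s ih =>
    have hvan : ∀ a : F[X], a.degree < (s + 1 : ℕ) → carlitzMap F (s + 1) a = 0 := by
      intro a ha
      have hsplit : a = a.coeff s • X ^ s + (a - a.coeff s • X ^ s) := by ring
      have hlow : degree (a - a.coeff s • X ^ s) < (s : WithBot ℕ) := by
        rw [degree_lt_iff_coeff_zero]
        intro m hm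
        rcases hm.eq_or_lt with rfl | hm
        · simp
        · have : a.coeff m = 0 := coeff_eq_zero_of_degree_lt (ha.trans_le (by exact_mod_cast hm))
          simp [this, coeff_X_pow, hm.ne']
      have hval : carlitzMap F s a = a.coeff s • carlitzF F s := by
        conv_lhs => rw [hsplit]
        rw [map_add, map_smul, ih.1 _ hlow, ih.2, add_zero]
      -- The coefficient `c` of `t^s` satisfies `c ^ q = c`, so the two terms of the recursion
      -- cancel at `c F_s`.
      rw [carlitzMap_succ, hval, _root_.smul_pow, FiniteField.pow_card, mul_smul_comm, ← pow_succ,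
        Nat.sub_add_cancel Fintype.card_pos, sub_self]
    refine ⟨hvan, ?_⟩
    rw [pow_succ', carlitzMap_succ_X_mul, ih.2, hvan, mul_zero, zero_add, carlitzF_succ]
    rw [degree_X_pow]
    exact_mod_cast Nat.lt_succ_self s

theorem carlitzMap_eq_zero {s : ℕ} {a : F[X]} (ha : a.degree < s) : carlitzMap F s a = 0 :=
  (carlitzMap_vanish_and_X_pow F s).1 a ha

theorem carlitzMap_monic {s : ℕ} {a : F[X]} (ha : a.Monic) (hs : a.natDegree = s) :
    carlitzMap F s a = carlitzF F s := by
  subst hs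
  rw [← sub_add_cancel a (X ^ a.natDegree), map_add,
    carlitzMap_eq_zero, zero_add, sub_add_cancel, (carlitzMap_vanish_and_X_pow F _).2]
  rw [sub_add_cancel]
  refine (degree_sub_lt_left ?_ ha.ne_zero ?_).trans_eq (degree_eq_natDegree ha.ne_zero)
  · rw [degree_X_pow, degree_eq_natDegree ha.ne_zero]
  · rw [ha.leadingCoeff, leadingCoeff_X_pow]

/-- By linearity it is enough to treat `t^n`. Induction on `n` inside induction on `s` then works,
because both summands of `carlitzMap_succ_X_mul` are divisible by `F_(s+1)`. -/
theorem carlitzF_dvd_carlitzMap (s : ℕ) (a : F[X]) : carlitzF F s ∣ carlitzMap F s a := by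
  induction s generalizing a with
  | zero => simp [carlitzF_zero]
  | succ s ih =>
    induction a using Polynomial.induction_on' with
    | add p q hp hq => rw [map_add]; exact dvd_add hp hq
    | monomial n c =>
      rw [← smul_X_eq_monomial, map_smul]
      refine dvd_smul_of_dvd c ?_
      induction n with
      | zero =>
        rw [pow_zero, carlitzMap_eq_zero]
        · exact dvd_zero _
        · rw [degree_one]; exact_mod_cast Nat.succ_pos s
      | succ n ihn =>
        rw [pow_succ', carlitzMap_succ_X_mul]
        refine dvd_add (ihn.mul_left _) ?_
        rw [carlitzF_succ]
        exact mul_dvd_mul_left _ (pow_dvd_pow_of_dvd (ih _) _)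

end CarlitzMap

/-! ### The product `ψ_s` satisfies the recursion -/

section CarlitzPsi

variable (F : Type*) [Field F] [Fintype F]

theorem card_setOf_degree_lt (m : ℕ) :
    (finite_setOf_degree_lt F m).toFinset.card = Fintype.card F ^ m := by
  have h2 : {f : F[X] | f.degree < m} = (degreeLT F m : Set F[X]) := by
    ext f
    simp [mem_degreeLT]
  rw [← Set.ncard_eq_toFinset_card _ (finite_setOf_degree_lt F m), h2, ← Nat.card_coe_set_eq]
  refine (Nat.card_congr (degreeLTEquiv F m).toEquiv).trans ?_
  simp

theorem carlitzPsi_monic (m : ℕ) : (carlitzPsi F m).Monic :=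
  monic_prod_of_monic _ _ fun _ _ => monic_X_sub_C _

theorem natDegree_carlitzPsi (m : ℕ) : (carlitzPsi F m).natDegree = Fintype.card F ^ m := by
  rw [carlitzPsi, natDegree_prod_of_monic _ _ fun _ _ => monic_X_sub_C _]
  simp [card_setOf_degree_lt]

theorem carlitzPsi_zero : carlitzPsi F 0 = X := by
  have : (finite_setOf_degree_lt F 0).toFinset = {0} := by
    ext f
    simp
  rw [carlitzPsi, this, Finset.prod_singleton, map_zero, map_zero, sub_zero]

theorem eval_carlitzPsi (s : ℕ) (a : F[X]) :
    (carlitzPsi F s).eval (algebraMap F[X] (RatFunc F) a) =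
      algebraMap F[X] (RatFunc F) (carlitzMap F s a) := by
  induction s generalizing a with
  | zero => simp [carlitzPsi_zero, carlitzMap_zero]
  | succ s ih =>
    have hq : 1 < Fintype.card F := Fintype.one_lt_card
    set c : RatFunc F := algebraMap F[X] (RatFunc F) (carlitzF F s ^ (Fintype.card F - 1))
    set p : (RatFunc F)[X] := carlitzPsi F s ^ Fintype.card F - C c * carlitzPsi F s with hp
    have hpe : ∀ a : F[X], p.eval (algebraMap F[X] (RatFunc F) a) =
        algebraMap F[X] (RatFunc F) (carlitzMap F (s + 1) a) := by
      intro a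
      simp [hp, c, ih, carlitzMap_succ]
    have hlt : (C c * carlitzPsi F s).degree < (carlitzPsi F s ^ Fintype.card F).degree := by
      have hc : c ≠ 0 := by
        simpa [c] using fun h => absurd h (carlitzF_ne_zero F s)
      rw [degree_C_mul hc, degree_pow, degree_eq_natDegree (carlitzPsi_monic F s).ne_zero, natDegree_carlitzPsi,
        nsmul_eq_mul]
      norm_cast
      exact lt_mul_of_one_lt_left (by positivity) hq
    have hpm : p.Monic := ((carlitzPsi_monic F s).pow _).sub_of_left hlt
    have hpd : p.degree = (carlitzPsi F (s + 1)).degree := by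
      rw [hp, degree_sub_eq_left_of_degree_lt hlt, degree_pow,
        degree_eq_natDegree (carlitzPsi_monic F s).ne_zero,
        degree_eq_natDegree (carlitzPsi_monic F (s + 1)).ne_zero, natDegree_carlitzPsi,
        natDegree_carlitzPsi, nsmul_eq_mul, pow_succ']
      norm_cast
    -- Both sides are monic of degree `q^(s+1)`, so their difference has smaller degree; it vanishes
    -- at the `q^(s+1)` polynomials of degree `< s + 1`.
    have : p = carlitzPsi F (s + 1) := by
      refine eq_of_degree_sub_lt_of_eval_index_eq (finite_setOf_degree_lt F (s + 1)).toFinset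
        (v := algebraMap F[X] (RatFunc F)) (IsFractionRing.injective F[X] (RatFunc F)).injOn ?_ ?_
      · refine (degree_sub_lt_left hpd hpm.ne_zero
          (hpm.leadingCoeff.trans (carlitzPsi_monic F _).leadingCoeff.symm)).trans_eq ?_
        rw [hpd, degree_eq_natDegree (carlitzPsi_monic F _).ne_zero, natDegree_carlitzPsi,
          card_setOf_degree_lt]
      · intro f hf
        rw [hpe, carlitzMap_eq_zero F (by simpa using hf), map_zero, carlitzPsi, eval_prod]
        exact (Finset.prod_eq_zero hf (by simp)).symm
    rw [← this]
    exact hpe a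

end CarlitzPsi

/-! ### Integrality and digit factorization of `β_k` -/

section CarlitzBinomial

variable (F : Type*) [Field F] [Fintype F]

/-- The polynomial `ψ_s / F_s`. -/
noncomputable def carlitzE (s : ℕ) : (RatFunc F)[X] :=
  C (algebraMap F[X] (RatFunc F) (carlitzF F s))⁻¹ * carlitzPsi F s

theorem algebraMap_carlitzF_ne_zero (s : ℕ) :
    algebraMap F[X] (RatFunc F) (carlitzF F s) ≠ 0 := by
  simpa using carlitzF_ne_zero F s

theorem carlitzE_ne_zero (s : ℕ) : carlitzE F s ≠ 0 :=
  mul_ne_zero (C_ne_zero.mpr (inv_ne_zero (algebraMap_carlitzF_ne_zero F s)))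
    (carlitzPsi_monic F s).ne_zero

theorem natDegree_carlitzE (s : ℕ) : (carlitzE F s).natDegree = Fintype.card F ^ s := by
  rw [carlitzE, natDegree_C_mul (inv_ne_zero (algebraMap_carlitzF_ne_zero F s)),
    natDegree_carlitzPsi]

theorem carlitzE_mem (s : ℕ) : carlitzE F s ∈ integerValuedPolynomials F[X] (RatFunc F) := by
  intro a
  obtain ⟨b, hb⟩ := carlitzF_dvd_carlitzMap F s a
  refine ⟨b, ?_⟩
  rw [carlitzE, eval_mul, eval_C, eval_carlitzPsi, hb, map_mul,
    inv_mul_cancel_left₀ (algebraMap_carlitzF_ne_zero F s)]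

theorem eval_carlitzE_of_monic {s : ℕ} {a : F[X]} (ha : a.Monic) (hs : a.natDegree = s) :
    (carlitzE F s).eval (algebraMap F[X] (RatFunc F) a) = 1 := by
  rw [carlitzE, eval_mul, eval_C, eval_carlitzPsi, carlitzMap_monic F ha hs,
    inv_mul_cancel₀ (algebraMap_carlitzF_ne_zero F s)]

theorem carlitzBinomial_eq_prod_carlitzE (k : ℕ) :
    carlitzBinomial F k = ∏ i ∈ Finset.range (Nat.digits (Fintype.card F) k).length,
      carlitzE F i ^ (Nat.digits (Fintype.card F) k).getD i 0 := by
  simp only [carlitzBinomial, carlitzg, carlitzG, carlitzE, mul_pow, Finset.prod_mul_distrib,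
    map_prod, map_pow, ← Finset.prod_inv_distrib, ← inv_pow]

theorem carlitzBinomial_card_pow (s : ℕ) :
    carlitzBinomial F (Fintype.card F ^ s) = carlitzE F s := by
  have hq : 1 < Fintype.card F := Fintype.one_lt_card
  have hd : Nat.digits (Fintype.card F) (Fintype.card F ^ s) = List.replicate s 0 ++ [1] := by
    have := Nat.digits_base_pow_mul (k := s) hq one_pos
    rwa [mul_one, Nat.digits_of_lt _ 1 one_ne_zero hq] at this
  rw [carlitzBinomial_eq_prod_carlitzE, hd, List.length_append, List.length_replicate,
    List.length_singleton, Finset.prod_range_succ, Finset.prod_eq_one]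
  · simp
  · intro i hi
    have hi := Finset.mem_range.mp hi
    simp [List.getElem?_append, hi]

theorem carlitzBinomial_mem (k : ℕ) :
    carlitzBinomial F k ∈ integerValuedPolynomials F[X] (RatFunc F) := by
  rw [carlitzBinomial_eq_prod_carlitzE]
  exact Subring.prod_mem _ fun i _ => Subring.pow_mem _ (carlitzE_mem F i) _

theorem ofDigits_eq_sum_range (b : ℕ) (L : List ℕ) :
    Nat.ofDigits b L = ∑ i ∈ Finset.range L.length, L.getD i 0 * b ^ i := by
  induction L with
  | nil => simp
  | cons d L ih =>
    rw [Nat.ofDigits_cons, ih, List.length_cons, Finset.sum_range_succ', Finset.mul_sum, add_comm]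
    simp only [List.getD_cons_succ, List.getD_cons_zero, pow_zero, mul_one]
    congr 1
    exact Finset.sum_congr rfl fun i _ => by ring

theorem exists_digits_carlitzBinomial {k : ℕ} (hk : 0 < k) :
    ∃ (s : ℕ) (α : ℕ → ℕ), (∀ i ≤ s, α i < Fintype.card F) ∧ α s ≠ 0 ∧
      k = ∑ i ∈ Finset.range (s + 1), α i * Fintype.card F ^ i ∧
      carlitzBinomial F k = ∏ i ∈ Finset.range (s + 1), carlitzE F i ^ α i := by
  have hq : 1 < Fintype.card F := Fintype.one_lt_card
  have hne : Nat.digits (Fintype.card F) k ≠ [] := Nat.digits_ne_nil_iff_ne_zero.mpr hk.ne'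
  have hlen : (Nat.digits (Fintype.card F) k).length - 1 + 1 =
      (Nat.digits (Fintype.card F) k).length :=
    Nat.sub_add_cancel (List.length_pos_iff.mpr hne)
  refine ⟨(Nat.digits (Fintype.card F) k).length - 1,
    fun i => (Nat.digits (Fintype.card F) k).getD i 0, fun i _ => ?_, ?_, ?_, ?_⟩
  · beta_reduce
    rw [Nat.getD_digits _ _ hq]
    exact Nat.mod_lt _ (by omega)
  · have := Nat.getLast_digit_ne_zero (Fintype.card F) hk.ne'
    rw [List.getLast_eq_getElem] at this
    beta_reduce
    rwa [List.getD_eq_getElem _ _ (by omega)]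
  · rw [hlen, ← ofDigits_eq_sum_range, Nat.ofDigits_digits]
  · rw [hlen, carlitzBinomial_eq_prod_carlitzE]

end CarlitzBinomial

/-! ### A criterion for absolute irreducibility -/

section UniqueFactorization

theorem absolutelyIrreducible_of_dvd_pow {R : Type*} [CommMonoidWithZero R]
    [IsCancelMulZero R] {a : R} (h0 : a ≠ 0) (hu : ¬IsUnit a)
    (h : ∀ (m : ℕ) (b : R), b ∣ a ^ m → ∃ j : ℕ, Associated b (a ^ j)) :
    AbsolutelyIrreducible a := by
  have hinj : ∀ {i j : ℕ}, Associated (a ^ i) (a ^ j) → i = j := fun hij =>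
    le_antisymm ((pow_dvd_pow_iff h0 hu).mp hij.dvd) ((pow_dvd_pow_iff h0 hu).mp hij.symm.dvd)
  have hirr : Irreducible a := by
    refine ⟨hu, fun b c hbc => ?_⟩
    obtain ⟨i, hi⟩ := h 1 b (by rw [pow_one, hbc]; exact dvd_mul_right _ _)
    obtain ⟨j, hj⟩ := h 1 c (by rw [pow_one, hbc]; exact dvd_mul_left _ _)
    have hij : 1 = i + j := hinj (by rw [pow_one, pow_add]; nth_rw 1 [hbc]; exact hi.mul_mul hj)
    rcases i.eq_zero_or_pos with rfl | hi0
    · exact Or.inl (hi.isUnit_iff.mpr (by simp))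
    · obtain rfl : j = 0 := by omega
      exact Or.inr (hj.isUnit_iff.mpr (by simp))
  refine ⟨hirr, fun m _ => ⟨⟨Multiset.replicate m a, fun b hb => ?_, by simp⟩, ?_⟩⟩
  · rwa [Multiset.eq_of_mem_replicate hb]
  · have key : ∀ u : Multiset R, (∀ b ∈ u, Irreducible b) → u.prod = a ^ m →
        u.map Associates.mk = Multiset.replicate m (Associates.mk a) := by
      intro u hui hup
      have hass : ∀ b ∈ u, Associated b a := by
        intro b hb
        obtain ⟨j, hj⟩ := h m b (hup ▸ Multiset.dvd_prod hb)
        -- An irreducible element is neither `a ^ 0 = 1` nor a proper power.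
        have hj1 : j = 1 := by
          by_contra hne
          exact not_irreducible_pow hne (hj.irreducible (hui b hb))
        rwa [hj1, pow_one] at hj
      have hrel : u.map Associates.mk = Multiset.replicate (Multiset.card u) (Associates.mk a) :=
        Multiset.eq_replicate.mpr ⟨Multiset.card_map _ _, by
          simpa [Associates.mk_eq_mk_iff_associated] using hass⟩
      have hcard : Multiset.card u = m := by
        have hprod := congrArg Multiset.prod hrel
        rw [Associates.prod_mk, hup, Multiset.prod_replicate, ← Associates.mk_pow,
          Associates.mk_eq_mk_iff_associated] at hprod
        exact (hinj hprod).symm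
      rwa [hcard] at hrel
    intro u v hui hvi hup hvp
    rw [Associates.rel_associated_iff_map_eq_map, key u hui hup, key v hvi hvp]

end UniqueFactorization

/-! ### Divisors of powers of `E_s` -/

section Divisors

/-- The minimal polynomial of a primitive element of the degree `n` extension of `F` serves. -/
theorem exists_monic_irreducible_natDegree_eq (F : Type*) [Field F] [Fintype F] {n : ℕ}
    (hn : n ≠ 0) : ∃ P : F[X], P.Monic ∧ Irreducible P ∧ P.natDegree = n := by
  obtain ⟨p, _⟩ := CharP.exists F
  have : Fact p.Prime := ⟨CharP.char_is_prime F p⟩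
  have : NeZero n := ⟨hn⟩
  obtain ⟨α, hα⟩ := Field.exists_primitive_element F (FiniteField.Extension F p n)
  have hint : IsIntegral F α := IsIntegral.of_finite F α
  refine ⟨minpoly F α, minpoly.monic hint, minpoly.irreducible hint, ?_⟩
  rw [(Field.primitive_element_iff_minpoly_natDegree_eq F α).mp hα,
    FiniteField.finrank_extension]

theorem Prime.pow_mul_associated_pow_mul {R : Type*} [CommMonoidWithZero R]
    [IsCancelMulZero R] {p a b : R} (hp : Prime p) (ha : ¬p ∣ a) (hb : ¬p ∣ b) {i j : ℕ}
    (h : Associated (p ^ i * a) (p ^ j * b)) : i = j := by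
  refine le_antisymm ((pow_dvd_pow_iff hp.ne_zero hp.not_isUnit).mp ?_)
    ((pow_dvd_pow_iff hp.ne_zero hp.not_isUnit).mp ?_)
  · exact hp.pow_dvd_of_dvd_mul_right _ hb ((dvd_mul_right _ _).trans h.dvd)
  · exact hp.pow_dvd_of_dvd_mul_right _ ha ((dvd_mul_right _ _).trans h.symm.dvd)

variable {F : Type*} [Field F] [Fintype F]

theorem splits_carlitzPsi (s : ℕ) : (carlitzPsi F s).Splits :=
  Splits.prod fun _ _ => Splits.X_sub_C _

theorem exists_eq_C_mul_prod_of_dvd_carlitzPsi_pow {s m : ℕ} {g : (RatFunc F)[X]}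
    (hg : g ∣ carlitzPsi F s ^ m) :
    ∃ e : F[X] → ℕ, g = C g.leadingCoeff * ∏ f ∈ (finite_setOf_degree_lt F s).toFinset,
      (X - C (algebraMap F[X] (RatFunc F) f)) ^ e f := by
  classical
  have hψ : carlitzPsi F s ^ m ≠ 0 := pow_ne_zero _ (carlitzPsi_monic F s).ne_zero
  -- A divisor of a split polynomial splits, and its roots lie among the `f`; the exponents are the
  -- root multiplicities, possibly zero.
  refine ⟨fun f => g.roots.count (algebraMap F[X] (RatFunc F) f), ?_⟩
  have hsub : g.roots.toFinset ⊆
      (finite_setOf_degree_lt F s).toFinset.image (algebraMap F[X] (RatFunc F)) := by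
    intro a ha
    have hroot : (carlitzPsi F s ^ m).IsRoot a :=
      (isRoot_of_mem_roots (Multiset.mem_toFinset.mp ha)).dvd hg
    have hroot' : (carlitzPsi F s).eval a = 0 := by
      rw [IsRoot, eval_pow] at hroot
      exact eq_zero_of_pow_eq_zero hroot
    rw [carlitzPsi, eval_prod, Finset.prod_eq_zero_iff] at hroot'
    obtain ⟨f, hf, hfa⟩ := hroot'
    refine Finset.mem_image.mpr ⟨f, hf, ?_⟩
    rw [eval_sub, eval_X, eval_C, sub_eq_zero] at hfa
    exact hfa.symm
  conv_lhs => rw [(((splits_carlitzPsi s).pow m).of_dvd hψ hg).eq_prod_roots]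
  rw [Finset.prod_multiset_map_count, Finset.prod_subset hsub,
    Finset.prod_image (IsFractionRing.injective F[X] (RatFunc F)).injOn]
  intro a _ ha
  rw [Multiset.count_eq_zero_of_notMem (by simpa using ha), pow_zero]

theorem eval_isUnit_of_mul_eq_carlitzE_pow {s m : ℕ} {g h : (RatFunc F)[X]}
    (hg : g ∈ integerValuedPolynomials F[X] (RatFunc F))
    (hh : h ∈ integerValuedPolynomials F[X] (RatFunc F)) (hgh : g * h = carlitzE F s ^ m)
    {a : F[X]} (ha : a.Monic) (hs : a.natDegree = s) :
    ∃ u : F[X], IsUnit u ∧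
      g.eval (algebraMap F[X] (RatFunc F) a) = algebraMap F[X] (RatFunc F) u := by
  obtain ⟨x, hx⟩ := hg a
  obtain ⟨y, hy⟩ := hh a
  refine ⟨x, IsUnit.of_mul_eq_one y ?_, hx.symm⟩
  apply IsFractionRing.injective F[X] (RatFunc F)
  rw [map_mul, hx, hy, ← eval_mul, hgh, eval_pow, eval_carlitzE_of_monic F ha hs, one_pow,
    map_one]

theorem exponent_eq_of_associated {s : ℕ} {e : F[X] → ℕ}
    (h : ∀ a b : F[X], a.Monic → a.natDegree = s → b.Monic → b.natDegree = s →
      Associated (∏ f ∈ (finite_setOf_degree_lt F s).toFinset, (a - f) ^ e f)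
        (∏ f ∈ (finite_setOf_degree_lt F s).toFinset, (b - f) ^ e f))
    {f₀ f₁ : F[X]} (h₀ : f₀.degree < s) (h₁ : f₁.degree < s) : e f₀ = e f₁ := by
  classical
  -- In degree `0` there is no irreducible `P`, but `0` is the only admissible `f`.
  rcases eq_or_ne s 0 with rfl | hs
  · replace h₀ : f₀ = 0 := by simpa using h₀
    replace h₁ : f₁ = 0 := by simpa using h₁
    rw [h₀, h₁]
  obtain ⟨P, hPm, hPi, hPd⟩ := exists_monic_irreducible_natDegree_eq F hs
  have hdeg : P.degree = s := by rw [degree_eq_natDegree hPm.ne_zero, hPd]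
  have hsplit : ∀ f₀ : F[X], f₀.degree < s → ∃ A : F[X], ¬P ∣ A ∧
      ∏ f ∈ (finite_setOf_degree_lt F s).toFinset, (P + f₀ - f) ^ e f = P ^ e f₀ * A := by
    intro f₀ h₀
    refine ⟨∏ f ∈ (finite_setOf_degree_lt F s).toFinset.erase f₀, (P + f₀ - f) ^ e f, ?_, ?_⟩
    · intro hdvd
      obtain ⟨f, hf, hPf⟩ := hPi.prime.exists_mem_finset_dvd hdvd
      have hPf := hPi.prime.dvd_of_dvd_pow hPf
      rw [add_sub_assoc, dvd_add_right dvd_rfl] at hPf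
      rw [Finset.mem_erase, Set.Finite.mem_toFinset] at hf
      refine hf.1 (sub_eq_zero.mp (eq_zero_of_dvd_of_degree_lt hPf ?_)).symm
      rw [hdeg]
      exact (degree_sub_le _ _).trans_lt (max_lt h₀ hf.2)
    · rw [← Finset.mul_prod_erase _ _ ((finite_setOf_degree_lt F s).mem_toFinset.mpr h₀),
        add_sub_cancel_right]
  have hmonic : ∀ f₀ : F[X], f₀.degree < s → (P + f₀).Monic ∧ (P + f₀).natDegree = s :=
    fun f₀ h₀ => ⟨hPm.add_of_left (hdeg ▸ h₀),
      (natDegree_add_eq_left_of_degree_lt (hdeg ▸ h₀)).trans hPd⟩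
  obtain ⟨A, hA, hA'⟩ := hsplit f₀ h₀
  obtain ⟨B, hB, hB'⟩ := hsplit f₁ h₁
  have := h _ _ (hmonic f₀ h₀).1 (hmonic f₀ h₀).2 (hmonic f₁ h₁).1 (hmonic f₁ h₁).2
  rw [hA', hB'] at this
  exact hPi.prime.pow_mul_associated_pow_mul hA hB this

theorem eq_C_mul_carlitzE_pow_of_mul_eq {s m : ℕ} {g h : (RatFunc F)[X]}
    (hg : g ∈ integerValuedPolynomials F[X] (RatFunc F))
    (hh : h ∈ integerValuedPolynomials F[X] (RatFunc F)) (hgh : g * h = carlitzE F s ^ m) :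
    ∃ (u : F[X]) (j : ℕ), IsUnit u ∧
      g = C (algebraMap F[X] (RatFunc F) u) * carlitzE F s ^ j := by
  have hF0 := algebraMap_carlitzF_ne_zero F s
  have hdvd : g ∣ carlitzPsi F s ^ m := by
    refine (Dvd.intro h hgh).trans ?_
    refine Dvd.intro (C (algebraMap F[X] (RatFunc F) (carlitzF F s)) ^ m) ?_
    rw [← mul_pow, carlitzE, mul_right_comm, ← C_mul, inv_mul_cancel₀ hF0, C_1, one_mul]
  have hg0 : g ≠ 0 := ne_zero_of_dvd_ne_zero (pow_ne_zero _ (carlitzPsi_monic F s).ne_zero) hdvd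
  obtain ⟨e, he⟩ := exists_eq_C_mul_prod_of_dvd_carlitzPsi_pow hdvd
  have hc : g.leadingCoeff ≠ 0 := leadingCoeff_ne_zero.mpr hg0
  have heval : ∀ a : F[X], g.eval (algebraMap F[X] (RatFunc F) a) =
      g.leadingCoeff * algebraMap F[X] (RatFunc F)
        (∏ f ∈ (finite_setOf_degree_lt F s).toFinset, (a - f) ^ e f) := by
    intro a
    conv_lhs => rw [he]
    simp [eval_prod]
  have hconst : ∀ f ∈ (finite_setOf_degree_lt F s).toFinset, e f = e 0 := by
    intro f hf
    refine exponent_eq_of_associated (s := s) ?_ (by simpa using hf) (by simp)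
    intro a b ha has hb hbs
    obtain ⟨u, hu, hua⟩ := eval_isUnit_of_mul_eq_carlitzE_pow hg hh hgh ha has
    obtain ⟨v, hv, hvb⟩ := eval_isUnit_of_mul_eq_carlitzE_pow hg hh hgh hb hbs
    rw [heval] at hua hvb
    have key : (∏ f ∈ (finite_setOf_degree_lt F s).toFinset, (a - f) ^ e f) * v =
        (∏ f ∈ (finite_setOf_degree_lt F s).toFinset, (b - f) ^ e f) * u := by
      apply IsFractionRing.injective F[X] (RatFunc F)
      rw [map_mul, map_mul, ← hua, ← hvb]
      ring
    exact ((associated_mul_unit_right _ _ hv).trans (Associated.of_eq key)).trans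
      (associated_mul_unit_left _ _ hu)
  have hgψ : g = C g.leadingCoeff * carlitzPsi F s ^ e 0 := by
    conv_lhs => rw [he]
    rw [carlitzPsi, ← Finset.prod_pow, Finset.prod_congr rfl fun f hf => by rw [hconst f hf]]
  -- Evaluation at `t^s`, where `ψ_s` equals `F_s`, identifies the unit as `u = c F_s ^ j`, with `c`
  -- the leading coefficient of `g` and `j = e 0`.
  obtain ⟨u, hu, hue⟩ := eval_isUnit_of_mul_eq_carlitzE_pow hg hh hgh (monic_X_pow (R := F) s)
    (natDegree_X_pow s)
  refine ⟨u, e 0, hu, ?_⟩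
  rw [← hue, carlitzE, mul_pow, ← mul_assoc, ← C_pow, ← C_mul]
  conv_lhs => rw [hgψ]
  congr 2
  conv_rhs => rw [hgψ]
  rw [eval_mul, eval_C, eval_pow, eval_carlitzPsi, carlitzMap_monic F (monic_X_pow s)
    (natDegree_X_pow s), inv_pow, mul_inv_cancel_right₀ (pow_ne_zero _ hF0)]

end Divisors

/-! ### The main theorem -/

section Main

variable {F : Type*} [Field F] [Fintype F]

theorem integerValuedPolynomials.natDegree_eq_zero_of_isUnit {D K : Type*} [CommRing D] [Field K] [Algebra D K]
    {f : integerValuedPolynomials D K} (hf : IsUnit f) : (f : K[X]).natDegree = 0 :=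
  Polynomial.natDegree_eq_zero_of_isUnit (hf.map (integerValuedPolynomials D K).subtype)

theorem absolutelyIrreducible_carlitzE (s : ℕ) :
    AbsolutelyIrreducible
      (⟨carlitzE F s, carlitzE_mem F s⟩ : integerValuedPolynomials F[X] (RatFunc F)) := by
  refine absolutelyIrreducible_of_dvd_pow ?_ ?_ ?_
  · exact fun h => carlitzE_ne_zero F s (congrArg Subtype.val h)
  · intro h
    have := integerValuedPolynomials.natDegree_eq_zero_of_isUnit h
    rw [natDegree_carlitzE] at this
    exact pow_ne_zero s Fintype.card_ne_zero this
  · rintro m ⟨g, hg⟩ ⟨⟨h, hh⟩, hgh⟩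
    obtain ⟨u, j, hu, hguj⟩ := eq_C_mul_carlitzE_pow_of_mul_eq hg hh
      (congrArg Subtype.val hgh).symm
    -- Constants embed `F[t]` in the ring, so a unit of `F[t]` stays a unit there.
    let ι : F[X] →+* integerValuedPolynomials F[X] (RatFunc F) :=
      (C.comp (algebraMap F[X] (RatFunc F))).codRestrict _ fun b a => ⟨b, by simp⟩
    refine ⟨j, Associated.symm ⟨(hu.map ι).unit, Subtype.ext ?_⟩⟩
    rw [mul_comm]
    exact hguj.symm

end Main

theorem theorem1 (F : Type*) [Field F] [Fintype F] (q : ℕ) (hq : Fintype.card F = q) :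
    ∃ hβ : ∀ k : ℕ, carlitzBinomial F k ∈ integerValuedPolynomials F[X] (RatFunc F),
      (∀ k : ℕ, 0 < k →
        (Irreducible (⟨carlitzBinomial F k, hβ k⟩ : integerValuedPolynomials F[X] (RatFunc F)) ↔
          ∃ s : ℕ, k = q ^ s) ∧
        ∃ (s : ℕ) (α : ℕ → ℕ), (∀ i ≤ s, α i < q) ∧ α s ≠ 0 ∧
          k = ∑ i ∈ Finset.range (s + 1), α i * q ^ i ∧
          carlitzBinomial F k =
            ∏ i ∈ Finset.range (s + 1), carlitzBinomial F (q ^ i) ^ α i) ∧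
      ∀ s : ℕ, AbsolutelyIrreducible
        (⟨carlitzBinomial F (q ^ s), hβ (q ^ s)⟩ :
          integerValuedPolynomials F[X] (RatFunc F)) := by
  subst hq
  have habs : ∀ s : ℕ, AbsolutelyIrreducible
      (⟨carlitzBinomial F (Fintype.card F ^ s), carlitzBinomial_mem F _⟩ :
        integerValuedPolynomials F[X] (RatFunc F)) := by
    intro s
    simp only [carlitzBinomial_card_pow]
    exact absolutelyIrreducible_carlitzE s
  refine ⟨carlitzBinomial_mem F, fun k hk => ?_, habs⟩
  obtain ⟨s, α, hα, hαs, hk', hprod⟩ := exists_digits_carlitzBinomial F hk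
  refine ⟨⟨fun hirr => ⟨s, ?_⟩, ?_⟩, s, α, hα, hαs, hk', ?_⟩
  -- `r` is the cofactor left after removing one factor `E_s`, which is possible as the top digit is
  -- nonzero.
  · set r : (RatFunc F)[X] :=
      (∏ i ∈ Finset.range s, carlitzE F i ^ α i) * carlitzE F s ^ (α s - 1) with hr
    have hrmem : r ∈ integerValuedPolynomials F[X] (RatFunc F) :=
      Subring.mul_mem _
        (Subring.prod_mem _ fun i _ => Subring.pow_mem _ (carlitzE_mem F i) _)
        (Subring.pow_mem _ (carlitzE_mem F s) _)
    have hfac : carlitzBinomial F k = carlitzE F s * r := by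
      rw [hprod, Finset.prod_range_succ, hr, mul_left_comm, ← pow_succ',
        Nat.sub_add_cancel (Nat.pos_of_ne_zero hαs)]
    have hdeg : k = (carlitzE F s * r).natDegree := by
      rw [← hfac, hprod, natDegree_prod _ _ fun i _ => pow_ne_zero _ (carlitzE_ne_zero F i)]
      simpa only [natDegree_pow, natDegree_carlitzE] using hk'
    rcases hirr.isUnit_or_isUnit (a := ⟨carlitzE F s, carlitzE_mem F s⟩) (b := ⟨r, hrmem⟩)
      (Subtype.ext hfac) with h | h
    · exact absurd h (absolutelyIrreducible_carlitzE s).1.not_isUnit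
    · have hr0 : r ≠ 0 := mul_ne_zero
        (Finset.prod_ne_zero_iff.mpr fun i _ => pow_ne_zero _ (carlitzE_ne_zero F i))
        (pow_ne_zero _ (carlitzE_ne_zero F s))
      rw [hdeg, natDegree_mul (carlitzE_ne_zero F s) hr0, natDegree_carlitzE,
        integerValuedPolynomials.natDegree_eq_zero_of_isUnit h, add_zero]
  · rintro ⟨j, rfl⟩
    exact (habs j).1
  · simpa only [carlitzBinomial_card_pow] using hprod
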